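/- Let $d\ge 1$ and, for $i=1,\dots,d$, let $1<\alpha_i<2$ and $d_{i,+},d_{i,-}\ge 0$. For real $a_i<b_i$, integers $n_i\ge 1$, a final time $T>0$ and a number $M\ge 1$ of time steps, put $n=n_1\cdots n_d$, $\tau=T/M$, $\nu=1/\tau$, $h_i=(b_i-a_i)/(n_i+1)$, $v_{i,\pm}=d_{i,\pm}/(2h_i^{\alpha_i})$. Let $g_0^{(\alpha)}=1$, $g_k^{(\alpha)}=\bigl(1-\frac{\alpha+1}{k}\bigr)g_{k-1}^{(\alpha)}$, $w_0^{(\alpha)}=\frac{\alpha}{2}g_0^{(\alpha)}$, $w_k^{(\alpha)}=\frac{\alpha}{2}g_k^{(\alpha)}+\frac{2-\alpha}{2}g_{k-1}^{(\alpha)}$ for $k\ge1$, and let $L_m^{(\alpha)}\in\mathbb R^{m\times m}$ be the Toeplitz matrix whose $(p,q)$ entry is $-w_{p-q+1}^{(\alpha)}$ if $p-q+1\ge 0$ and $0$ otherwise. Define the matrix of the second-order (Crank–Nicolson, weighted and shifted Grünwald) scheme by $$A_n=\nu I_n+\sum_{i=1}^d\bigl(v_{i,+}W_i+v_{i,-}W_i^{\top}\bigr),\qquad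 W_i=I_{n_1\cdots n_{i-1}}\otimes L_{n_i}^{(\alpha_i)}\otimes I_{n_{i+1}\cdots n_d},$$ let $\mathcal H(A_n)=(A_n+A_n^{\top})/2$, and let $Y_n=Y_{n_1}\otimes\cdots\otimes Y_{n_d}$, where $Y_m$ is the $m\times m$ anti-identity matrix. Put $$\mu=\max_{1\le i\le d}\frac{|d_{i,+}-d_{i,-}|}{d_{i,+}+d_{i,-}}\left|\tan\left(\frac{\alpha_i}{2}\pi\right)\right|,$$ where the term of an index with $d_{i,+}=d_{i,-}=0$ is read as $0$. Then there is a number $\varepsilon\ge 0$, depending only on $d$ and the $\alpha_i$, $d_{i,\pm}$ (not on the $n_i$, $a_i$, $b_i$, $T$, $M$), with $\varepsilon<\mu$ if $\mu>0$ and $\varepsilon=0$ if $\mu=0$, such that for all $a_i<b_i$, $n_i\ge1$, $T>0$, $M\ge1$ the matrix $\mathcal H(A_n)$ is invertible and all (complex) eigenvalues of $\mathcal H(A_n)^{-1}Y_nA_n$ are real and lie in $[-(1+\varepsilon),-1]\cup[1,1+\varepsilon]$. -/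

import Mathlib

noncomputable section

namespace FracDiff

/-- Grünwald coefficients: `g 0 = 1`, `g k = (1 - (α + 1) / k) * g (k - 1)` for `k ≥ 1`. -/
def grunwald (α : ℝ) : ℕ → ℝ
  | 0 => 1
  | k + 1 => (1 - (α + 1) / ((k : ℝ) + 1)) * grunwald α k

/-- Coefficients of the weighted and shifted Grünwald scheme. -/
def wCoeff (α : ℝ) : ℕ → ℝ
  | 0 => α / 2 * grunwald α 0
  | k + 1 => α / 2 * grunwald α (k + 1) + (2 - α) / 2 * grunwald α k

/-- The `m × m` lower Hessenberg Toeplitz matrix with `(p, q)` entry `-w_{p - q + 1}`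
if `p - q + 1 ≥ 0` and `0` otherwise. -/
def grunwaldMatrix (α : ℝ) (m : ℕ) : Matrix (Fin m) (Fin m) ℝ :=
  Matrix.of fun p q =>
    if (q : ℕ) ≤ (p : ℕ) + 1 then -wCoeff α ((p : ℕ) + 1 - (q : ℕ)) else 0

/-- The `m × m` anti-identity (flip) matrix. -/
def flipMatrix (m : ℕ) : Matrix (Fin m) (Fin m) ℝ :=
  Matrix.of fun p q => if (p : ℕ) + (q : ℕ) + 1 = m then 1 else 0

/-- Multi-indices `(p_1, …, p_d)` with `p_i` in a set of size `n_i`. They index the rows and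
columns of an `n × n` matrix, `n = n_1 ⋯ n_d`. -/
abbrev MultiIndex {d : ℕ} (n : Fin d → ℕ) : Type := (i : Fin d) → Fin (n i)

/-- The Kronecker product `M_1 ⊗ ⋯ ⊗ M_d` of square matrices, indexed by multi-indices. -/
def kron {d : ℕ} {n : Fin d → ℕ} (M : (i : Fin d) → Matrix (Fin (n i)) (Fin (n i)) ℝ) :
    Matrix (MultiIndex n) (MultiIndex n) ℝ :=
  Matrix.of fun p q => ∏ i, M i (p i) (q i)

/-- `I ⊗ ⋯ ⊗ I ⊗ B ⊗ I ⊗ ⋯ ⊗ I` with `B` as the `i`-th factor. -/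
def kronAt {d : ℕ} {n : Fin d → ℕ} (i : Fin d) (B : Matrix (Fin (n i)) (Fin (n i)) ℝ) :
    Matrix (MultiIndex n) (MultiIndex n) ℝ :=
  kron (Function.update (fun _ => 1) i B)

/-- The multilevel flip matrix `Y_{n_1} ⊗ ⋯ ⊗ Y_{n_d}`. -/
def multiFlip {d : ℕ} (n : Fin d → ℕ) : Matrix (MultiIndex n) (MultiIndex n) ℝ :=
  kron fun i => flipMatrix (n i)

/-- Spatial step size on `(a, b)` with `m` interior grid points. -/
def stepSize (a b : ℝ) (m : ℕ) : ℝ := (b - a) / ((m : ℝ) + 1)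

/-- The coefficient matrix
`ν I + ∑ i, (v_{i,+} W_i + v_{i,-} W_iᵀ)`, `ν = 1 / τ`, `v_{i,±} = d_{i,±} / (2 h_i ^ α_i)`,
`W_i = I ⊗ L_{n_i}^{(α_i)} ⊗ I`, of the Crank–Nicolson scheme in time with the weighted and
shifted Grünwald scheme in space. -/
def schemeMatrix {d : ℕ} (α dPlus dMinus a b : Fin d → ℝ) (τ : ℝ) (n : Fin d → ℕ) :
    Matrix (MultiIndex n) (MultiIndex n) ℝ :=
  (1 / τ) • (1 : Matrix (MultiIndex n) (MultiIndex n) ℝ) +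
    ∑ i, ((dPlus i / (2 * stepSize (a i) (b i) (n i) ^ α i)) •
            kronAt i (grunwaldMatrix (α i) (n i)) +
          (dMinus i / (2 * stepSize (a i) (b i) (n i) ^ α i)) •
            (kronAt i (grunwaldMatrix (α i) (n i))).transpose)

/-- The symmetric part `(A + Aᵀ) / 2`. -/
def symPart {ι : Type*} (A : Matrix ι ι ℝ) : Matrix ι ι ℝ :=
  (1 / 2 : ℝ) • (A + A.transpose)

/-- `max_i |d_{i,+} - d_{i,-}| / (d_{i,+} + d_{i,-}) * |tan (α_i π / 2)|`; the term of an index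
with `d_{i,+} = d_{i,-} = 0` counts as `0`. -/
def skewBound {d : ℕ} [NeZero d] (α dPlus dMinus : Fin d → ℝ) : ℝ :=
  Finset.univ.sup' Finset.univ_nonempty fun i : Fin d =>
    |dPlus i - dMinus i| / (dPlus i + dMinus i) * |Real.tan (α i / 2 * Real.pi)|

end FracDiff

end

/-! ### Grünwald coefficients and their generating functions. -/

namespace FracDiff

/-! Write A = `schemeMatrix`, Y = `multiFlip`, H = `symPart A` and K = H⁻¹A - 1. The proof joins a
flip symmetry with a bound on the numerical range of A.

Algebra: Toeplitz structure gives Y A Y = Aᵀ, so Y commutes with H and (H⁻¹YA)² = H⁻¹Aᵀ H⁻¹A = (1 -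
K)(1 + K) = 1 - K². Since HK is skew-symmetric and H is positive definite, the eigenvalues of K are
i s with s = Im(u*Au) / Re(u*Au) for an eigenvector u. Every eigenvalue l of H⁻¹YA therefore
satisfies l² = 1 + s² (`exists_sq_eq_one_add_sq`), and it remains to show |s| ≤ μ. This allows ε =
√(1 + μ²) - 1.

Analysis: x*Lx is an integral of the symbol of L against a nonnegative weight
(`pi_mul_quadForm_grunwaldMatrix`). The closed form `symbol_eq` places the symbol in the sector |Im|
≤ |tan(απ/2)| Re (`abs_im_symbol_le`). Kronecker factors I preserve the sector, and d₊L + d₋Lᵀ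
narrows it by |d₊ - d₋| / (d₊ + d₋), which yields μ (`abs_im_quadForm_schemeMatrix_le`). -/

theorem Ring_choose_succ_mul (a : ℂ) (k : ℕ) :
    Ring.choose a (k + 1) * (k + 1) = Ring.choose a k * (a - k) := by
  have hk : ((k : ℂ) + 1) ≠ 0 := by exact_mod_cast Nat.succ_ne_zero k
  have hf : ((k.factorial : ℕ) : ℂ) ≠ 0 := by exact_mod_cast Nat.factorial_ne_zero k
  rw [Ring.choose_eq_smul, Ring.choose_eq_smul, descPochhammer_succ_right, Polynomial.smeval_mul,
    Polynomial.smeval_sub, Polynomial.smeval_X, Polynomial.smeval_natCast, Nat.factorial_succ]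
  simp only [smul_eq_mul, pow_one, pow_zero, nsmul_eq_mul, mul_one]
  push_cast
  field_simp

theorem grunwald_eq_choose (α : ℝ) (k : ℕ) :
    ((grunwald α k : ℝ) : ℂ) = (-1) ^ k * Ring.choose (α : ℂ) k := by
  induction k with
  | zero => simp [grunwald]
  | succ k ih =>
    have hk : ((k : ℂ) + 1) ≠ 0 := by exact_mod_cast Nat.succ_ne_zero k
    have h := Ring_choose_succ_mul (α : ℂ) k
    rw [grunwald]
    push_cast
    rw [ih, ← mul_left_inj' hk, mul_assoc ((-1) ^ (k + 1)), h]
    field_simp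
    ring

theorem hasSum_grunwald_of_norm_lt_one (α : ℝ) {z : ℂ} (hz : ‖z‖ < 1) :
    HasSum (fun k => ((grunwald α k : ℝ) : ℂ) * z ^ k) ((1 - z) ^ (α : ℂ)) := by
  have h := (Complex.one_add_cpow_hasFPowerSeriesOnBall_zero (a := (α : ℂ))).hasSum
    (y := -z) (by simpa [enorm_eq_nnnorm, ← NNReal.coe_lt_one] using hz)
  simp only [binomialSeries_apply, zero_add, List.ofFn_const, List.prod_replicate,
    smul_eq_mul] at h
  rw [sub_eq_add_neg]
  refine h.congr_fun fun k => ?_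
  rw [grunwald_eq_choose, neg_pow z]
  ring

theorem grunwald_sum (α : ℝ) (hα : α ≠ 0) (n : ℕ) :
    ∑ k ∈ Finset.range (n + 1), grunwald α k = -((n + 1) * grunwald α (n + 1)) / α := by
  induction n with
  | zero => simp [grunwald]; field_simp
  | succ n ih =>
    rw [Finset.sum_range_succ, ih]
    conv_rhs => rw [grunwald]
    have hn : ((n : ℝ) + 1 + 1) ≠ 0 := by positivity
    push_cast
    field_simp
    ring

theorem grunwald_nonneg {α : ℝ} (h1 : 1 < α) (h2 : α < 2) (k : ℕ) : 0 ≤ grunwald α (k + 2) := by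
  induction k with
  | zero => simp [grunwald]; nlinarith
  | succ k ih =>
    rw [grunwald]
    refine mul_nonneg ?_ ih
    have hk : (0 : ℝ) ≤ k := k.cast_nonneg
    have : (0 : ℝ) < ((k + 2 : ℕ) : ℝ) + 1 := by positivity
    rw [sub_nonneg, div_le_one this]
    push_cast
    linarith

theorem summable_abs_grunwald {α : ℝ} (h1 : 1 < α) (h2 : α < 2) :
    Summable fun k => |grunwald α k| := by
  rw [← summable_nat_add_iff 2]
  -- Here g₀ + g₁ = 1 - α and all later terms are nonnegative. The partial sums are nonpositive by
  -- `grunwald_sum`, so the tail is at most α - 1.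
  refine summable_of_sum_range_le (c := α - 1) (fun _ => abs_nonneg _) fun n => ?_
  simp_rw [abs_of_nonneg (grunwald_nonneg h1 h2 _)]
  have h := grunwald_sum α (by linarith) (n + 1)
  rw [Finset.sum_range_succ', Finset.sum_range_succ'] at h
  have h3 : -((((n + 1 : ℕ) : ℝ) + 1) * grunwald α (n + 1 + 1)) / α ≤ 0 :=
    div_nonpos_of_nonpos_of_nonneg
      (neg_nonpos.2 (mul_nonneg (by positivity) (grunwald_nonneg h1 h2 n))) (by linarith)
  rw [← h] at h3
  simp [grunwald] at h3 ⊢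
  linarith

/-- Abel's limit argument: absolute summability makes the series continuous on the closed disc, so
the binomial identity at r z passes to r → 1. The power is continuous at 1 - z because Re(1 - z) >
0. -/
theorem hasSum_grunwald {α : ℝ} (h1 : 1 < α) (h2 : α < 2) {z : ℂ} (hz : ‖z‖ = 1) (hz1 : z ≠ 1) :
    HasSum (fun k => ((grunwald α k : ℝ) : ℂ) * z ^ k) ((1 - z) ^ (α : ℂ)) := by
  have hbd : ∀ (n : ℕ) (x : ℂ), x ∈ Metric.closedBall (0 : ℂ) 1 →
      ‖((grunwald α n : ℝ) : ℂ) * x ^ n‖ ≤ |grunwald α n| := by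
    intro n x hx
    rw [mem_closedBall_zero_iff] at hx
    rw [norm_mul, norm_pow, Complex.norm_real, Real.norm_eq_abs]
    exact mul_le_of_le_one_right (abs_nonneg _) (pow_le_one₀ (norm_nonneg _) hx)
  have hzm : z ∈ Metric.closedBall (0 : ℂ) 1 := by simp [hz]
  have hcont : ContinuousOn (fun x : ℂ => ∑' n, ((grunwald α n : ℝ) : ℂ) * x ^ n)
      (Metric.closedBall 0 1) :=
    continuousOn_tsum (fun i => by fun_prop) (summable_abs_grunwald h1 h2) hbd
  have hslit : 1 - z ∈ Complex.slitPlane := by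
    left
    have hre : z.re ≤ 1 := hz ▸ Complex.re_le_norm z
    rcases hre.lt_or_eq with h | h
    · simpa using h
    · exfalso
      apply hz1
      have h3 := Complex.sq_norm z
      rw [hz, Complex.normSq_apply, h] at h3
      apply Complex.ext
      · simpa using h
      · simpa using (by nlinarith : z.im * z.im = 0)
  have hray : Filter.Tendsto (fun r : ℝ => (r : ℂ) * z) (nhdsWithin 1 (Set.Ioo 0 1)) (nhds z) := by
    have : Continuous fun r : ℝ => (r : ℂ) * z := by fun_prop
    simpa using (this.tendsto 1).mono_left nhdsWithin_le_nhds
  have hin : ∀ r : ℝ, r ∈ Set.Ioo (0 : ℝ) 1 → ‖(r : ℂ) * z‖ < 1 := by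
    intro r hr
    rw [norm_mul, hz, mul_one, Complex.norm_real, Real.norm_eq_abs, abs_of_pos hr.1]
    exact hr.2
  have hlim1 : Filter.Tendsto (fun r : ℝ => ∑' n, ((grunwald α n : ℝ) : ℂ) * ((r : ℂ) * z) ^ n)
      (nhdsWithin 1 (Set.Ioo 0 1)) (nhds (∑' n, ((grunwald α n : ℝ) : ℂ) * z ^ n)) := by
    refine (hcont z hzm).tendsto.comp (tendsto_nhdsWithin_iff.2 ⟨hray, ?_⟩)
    filter_upwards [self_mem_nhdsWithin] with r hr
    simpa using (hin r hr).le
  have hlim2 : Filter.Tendsto (fun r : ℝ => (1 - (r : ℂ) * z) ^ (α : ℂ))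
      (nhdsWithin 1 (Set.Ioo 0 1)) (nhds ((1 - z) ^ (α : ℂ))) :=
    Filter.Tendsto.cpow (tendsto_const_nhds.sub hray) tendsto_const_nhds hslit
  have : (nhdsWithin (1 : ℝ) (Set.Ioo 0 1)).NeBot := right_nhdsWithin_Ioo_neBot (by norm_num)
  have heq := tendsto_nhds_unique (hlim1.congr' (by
    filter_upwards [self_mem_nhdsWithin] with r hr
    exact (hasSum_grunwald_of_norm_lt_one α (hin r hr)).tsum_eq)) hlim2
  rw [← heq]
  exact (Summable.of_norm_bounded (summable_abs_grunwald h1 h2) fun n => hbd n z hzm).hasSum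

theorem summable_abs_wCoeff {α : ℝ} (h1 : 1 < α) (h2 : α < 2) :
    Summable fun k => |wCoeff α k| := by
  have hs := (summable_abs_grunwald h1 h2).of_abs
  rw [summable_abs_iff, ← summable_nat_add_iff 1]
  exact (((summable_nat_add_iff 1).2 hs).mul_left _).add (hs.mul_left _)

theorem hasSum_wCoeff {α : ℝ} (h1 : 1 < α) (h2 : α < 2) {z : ℂ} (hz : ‖z‖ = 1) (hz1 : z ≠ 1) :
    HasSum (fun k => ((wCoeff α k : ℝ) : ℂ) * z ^ k)
      (((α : ℂ) / 2 + (2 - (α : ℂ)) / 2 * z) * (1 - z) ^ (α : ℂ)) := by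
  have h := hasSum_grunwald h1 h2 hz hz1
  have h' := (hasSum_nat_add_iff' 1).2 h
  rw [← hasSum_nat_add_iff' 1]
  have := (h'.mul_left ((α : ℂ) / 2)).add (h.mul_left ((2 - (α : ℂ)) / 2 * z))
  convert! this using 1
  · funext k
    simp only [wCoeff]
    push_cast
    ring
  · simp [wCoeff, grunwald]
    ring

end FracDiff

/-! ### The symbol and its sector. -/

noncomputable section

namespace FracDiff

open MeasureTheory

/-- The point `e^{2iψ}` of the unit circle. -/
def circlePt (ψ : ℝ) : ℂ := Complex.exp ((2 * ψ : ℝ) * Complex.I)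

theorem norm_circlePt (ψ : ℝ) : ‖circlePt ψ‖ = 1 := Complex.norm_exp_ofReal_mul_I _

theorem circlePt_ne_zero (ψ : ℝ) : circlePt ψ ≠ 0 := Complex.exp_ne_zero _

theorem continuous_circlePt : Continuous circlePt := by unfold circlePt; fun_prop

theorem circlePt_zpow (ψ : ℝ) (k : ℤ) :
    circlePt ψ ^ k = Complex.exp ((2 * Complex.I * k) * ψ) := by
  rw [circlePt, ← Complex.exp_int_mul]
  congr 1
  push_cast
  ring

theorem star_circlePt (ψ : ℝ) : star (circlePt ψ) = (circlePt ψ)⁻¹ := by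
  rw [Complex.inv_def, Complex.normSq_eq_norm_sq, norm_circlePt]
  simp

theorem integral_circlePt_zpow (k : ℤ) :
    ∫ ψ in (0 : ℝ)..Real.pi, circlePt ψ ^ k = if k = 0 then (Real.pi : ℂ) else 0 := by
  split_ifs with hk
  · simp [hk]
  · simp_rw [circlePt_zpow]
    have hk' : (2 * Complex.I * (k : ℂ)) ≠ 0 := by simp [hk]
    rw [integral_exp_mul_complex hk']
    have : 2 * Complex.I * (k : ℂ) * (Real.pi : ℂ) = k * (2 * Real.pi * Complex.I) := by ring
    rw [this, Complex.exp_int_mul_two_pi_mul_I]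
    simp

theorem one_sub_circlePt (ψ : ℝ) :
    1 - circlePt ψ = 2 * Real.sin ψ * Complex.exp (((ψ - Real.pi / 2 : ℝ) : ℂ) * Complex.I) := by
  have hc := Real.cos_two_mul ψ
  have hs := Real.sin_sq_add_cos_sq ψ
  rw [circlePt, Complex.exp_mul_I, Complex.exp_mul_I, ← Complex.ofReal_cos, ← Complex.ofReal_sin,
    ← Complex.ofReal_cos, ← Complex.ofReal_sin, Real.cos_sub_pi_div_two, Real.sin_sub_pi_div_two,
    Real.sin_two_mul]
  rw [hc, ← mul_one (2 * Real.cos ψ ^ 2 - 1)]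
  push_cast
  have h : (Real.sin ψ : ℂ) ^ 2 + (Real.cos ψ : ℂ) ^ 2 = 1 := by exact_mod_cast hs
  push_cast at h
  linear_combination -2 * h

theorem circlePt_ne_one {ψ : ℝ} (hψ : ψ ∈ Set.Ioo 0 Real.pi) : circlePt ψ ≠ 1 := by
  intro h
  have h2 := one_sub_circlePt ψ
  rw [h, sub_self] at h2
  have : (Real.sin ψ : ℂ) ≠ 0 := by exact_mod_cast (Real.sin_pos_of_mem_Ioo hψ).ne'
  simp [-Complex.ofReal_sin, this] at h2

/-- The generating function `∑ k, -w_k e^{2i(k-1)ψ}` of the weighted and shifted scheme. -/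
def symbol (α ψ : ℝ) : ℂ := -((circlePt ψ)⁻¹ * ∑' k, ((wCoeff α k : ℝ) : ℂ) * circlePt ψ ^ k)

theorem one_sub_circlePt_cpow (α : ℝ) {ψ : ℝ} (hψ : ψ ∈ Set.Ioo 0 Real.pi) :
    (1 - circlePt ψ) ^ (α : ℂ) = ((2 * Real.sin ψ) ^ α : ℝ) *
      Complex.exp (((α * (ψ - Real.pi / 2) : ℝ) : ℂ) * Complex.I) := by
  have hs : 0 < 2 * Real.sin ψ := by linarith [Real.sin_pos_of_mem_Ioo hψ]
  have h1 : 1 - circlePt ψ = Complex.exp ((Real.log (2 * Real.sin ψ) : ℝ) +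
      ((ψ - Real.pi / 2 : ℝ) : ℂ) * Complex.I) := by
    rw [Complex.exp_add, ← Complex.ofReal_exp, Real.exp_log hs, one_sub_circlePt]
    push_cast
    rfl
  have hne : 1 - circlePt ψ ≠ 0 := sub_ne_zero.2 (circlePt_ne_one hψ).symm
  -- The argument ψ - π/2 lies in (-π/2, π/2), so the principal logarithm returns it unchanged.
  rw [Complex.cpow_def_of_ne_zero hne, h1, Complex.log_exp, add_mul, Complex.exp_add,
    Real.rpow_def_of_pos hs]
  · push_cast
    congr 2
    ring
  · simp
    linarith [hψ.1, Real.pi_pos]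
  · simp
    linarith [hψ.2, Real.pi_pos]

/-- Splitting z = e^{2iψ} symmetrically turns the linear factor into (α/2)e^{-iψ} + ((2 -
α)/2)e^{iψ} = cos ψ - i(α - 1) sin ψ. The remaining e^{iψ} and the sign are absorbed into the phase
of (1 - z)^α. -/
theorem symbol_eq {α : ℝ} (h1 : 1 < α) (h2 : α < 2) {ψ : ℝ} (hψ : ψ ∈ Set.Ioo 0 Real.pi) :
    symbol α ψ = ((2 * Real.sin ψ) ^ α : ℝ) *
      (Complex.exp ((((α - 1) * (ψ - Real.pi / 2) : ℝ) : ℂ) * Complex.I) *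
        (((α - 1) * Real.sin ψ : ℝ) + (Real.cos ψ : ℝ) * Complex.I)) := by
  rw [symbol, (hasSum_wCoeff h1 h2 (norm_circlePt ψ) (circlePt_ne_one hψ)).tsum_eq,
    one_sub_circlePt_cpow α hψ]
  have hsplit : Complex.exp (((α * (ψ - Real.pi / 2) : ℝ) : ℂ) * Complex.I) =
      Complex.exp ((((α - 1) * (ψ - Real.pi / 2) : ℝ) : ℂ) * Complex.I) *
        (Complex.exp ((ψ : ℂ) * Complex.I) * -Complex.I) := by
    rw [← Complex.exp_neg_pi_div_two_mul_I, ← Complex.exp_add, ← Complex.exp_add]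
    congr 1
    push_cast
    ring
  have hz : circlePt ψ = Complex.exp ((ψ : ℂ) * Complex.I) ^ 2 := by
    rw [circlePt, ← Complex.exp_nat_mul]
    congr 1
    push_cast
    ring
  have hE : Complex.exp ((ψ : ℂ) * Complex.I) ≠ 0 := Complex.exp_ne_zero _
  have hcs : Complex.exp ((ψ : ℂ) * Complex.I) = Complex.cos ψ + Complex.sin ψ * Complex.I :=
    Complex.exp_mul_I _
  have hI : Complex.I ^ 2 = -1 := Complex.I_sq
  have key : (Complex.exp ((ψ : ℂ) * Complex.I))⁻¹ * Complex.I *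
      ((α : ℂ) / 2 + (2 - (α : ℂ)) / 2 * Complex.exp ((ψ : ℂ) * Complex.I) ^ 2) =
      (α - 1) * Complex.sin ψ + Complex.cos ψ * Complex.I := by
    have hcs2 := Complex.sin_sq_add_cos_sq (ψ : ℂ)
    rw [inv_mul_eq_div, div_mul_eq_mul_div, div_eq_iff hE, hcs]
    generalize Complex.cos (ψ : ℂ) = c at *
    generalize Complex.sin (ψ : ℂ) = s at *
    linear_combination (-Complex.I * α / 2) * hcs2 +
      ((1 - α / 2) * (2 * c * s + s ^ 2 * Complex.I) - c * s) * hI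
  rw [hsplit, hz]
  push_cast
  rw [← key]
  field_simp

/-- The antiderivative of `(1 - c²) sin ψ sin (c ψ)` vanishing at `0` is nonnegative. -/
theorem sector_aux {c : ℝ} (hc0 : 0 < c) (hc1 : c < 1) {ψ : ℝ} (hψ : ψ ∈ Set.Icc 0 Real.pi) :
    0 ≤ c * Real.sin ψ * Real.cos (c * ψ) - Real.cos ψ * Real.sin (c * ψ) := by
  have hd : ∀ x : ℝ, HasDerivAt
      (fun ψ => c * Real.sin ψ * Real.cos (c * ψ) - Real.cos ψ * Real.sin (c * ψ))
      ((1 - c ^ 2) * Real.sin x * Real.sin (c * x)) x := by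
    intro x
    have hl : HasDerivAt (fun x : ℝ => c * x) c x := by simpa using (hasDerivAt_id x).const_mul c
    convert! (((Real.hasDerivAt_sin x).const_mul c).mul hl.cos).sub
      ((Real.hasDerivAt_cos x).mul hl.sin) using 1
    ring
  have hm : MonotoneOn
      (fun ψ => c * Real.sin ψ * Real.cos (c * ψ) - Real.cos ψ * Real.sin (c * ψ))
      (Set.Icc 0 Real.pi) := by
    refine monotoneOn_of_deriv_nonneg (convex_Icc _ _)
      (fun x _ => (hd x).continuousAt.continuousWithinAt)
      (fun x _ => (hd x).differentiableAt.differentiableWithinAt) fun x hx => ?_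
    rw [interior_Icc] at hx
    rw [(hd x).deriv]
    refine mul_nonneg (mul_nonneg (by nlinarith) (Real.sin_pos_of_mem_Ioo hx).le)
      (Real.sin_nonneg_of_nonneg_of_le_pi (mul_nonneg hc0.le hx.1.le) ?_)
    nlinarith [hx.1, hx.2]
  have := hm (Set.left_mem_Icc.2 Real.pi_pos.le) hψ hψ.1
  simpa using this

theorem abs_tan_eq {α : ℝ} (h1 : 1 < α) (h2 : α < 2) :
    |Real.tan (α / 2 * Real.pi)| =
      Real.cos ((α - 1) * (Real.pi / 2)) / Real.sin ((α - 1) * (Real.pi / 2)) := by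
  have hp := Real.pi_pos
  have h : α / 2 * Real.pi = (α - 1) * (Real.pi / 2) + Real.pi / 2 := by ring
  have hc : 0 < Real.cos ((α - 1) * (Real.pi / 2)) :=
    Real.cos_pos_of_mem_Ioo ⟨by nlinarith, by nlinarith⟩
  have hs : 0 < Real.sin ((α - 1) * (Real.pi / 2)) :=
    Real.sin_pos_of_pos_of_lt_pi (by nlinarith) (by nlinarith)
  rw [h, Real.tan_eq_sin_div_cos, Real.sin_add_pi_div_two, Real.cos_add_pi_div_two, div_neg,
    abs_neg, abs_of_pos (div_pos hc hs)]

/-- With β = (α - 1)π/2 the tangent is cot β, and up to the modulus factor cos β · Re ∓ sin β · Im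
are the expressions of `sector_aux` at ψ and at π - ψ. -/
theorem abs_im_symbol_le {α : ℝ} (h1 : 1 < α) (h2 : α < 2) {ψ : ℝ}
    (hψ : ψ ∈ Set.Ioo 0 Real.pi) :
    |(symbol α ψ).im| ≤ |Real.tan (α / 2 * Real.pi)| * (symbol α ψ).re := by
  have hp := Real.pi_pos
  have hs : 0 < Real.sin ((α - 1) * (Real.pi / 2)) :=
    Real.sin_pos_of_pos_of_lt_pi (by nlinarith) (by nlinarith)
  have hr : 0 ≤ (2 * Real.sin ψ) ^ α :=
    Real.rpow_nonneg (by linarith [Real.sin_pos_of_mem_Ioo hψ]) _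
  have hD1 := sector_aux (c := α - 1) (by linarith) (by linarith) ⟨hψ.1.le, hψ.2.le⟩
  have hD2 := sector_aux (c := α - 1) (by linarith) (by linarith) (ψ := Real.pi - ψ)
    ⟨by linarith [hψ.2], by linarith [hψ.1]⟩
  have e1 : (α - 1) * ψ = (α - 1) * (ψ - Real.pi / 2) + (α - 1) * (Real.pi / 2) := by ring
  have e2 : (α - 1) * (Real.pi - ψ) =
      (α - 1) * (Real.pi / 2) - (α - 1) * (ψ - Real.pi / 2) := by ring
  rw [e1, Real.sin_add, Real.cos_add] at hD1
  rw [e2, Real.sin_pi_sub, Real.cos_pi_sub, Real.sin_sub, Real.cos_sub] at hD2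
  rw [symbol_eq h1 h2 hψ, abs_tan_eq h1 h2, Complex.exp_mul_I, ← Complex.ofReal_cos,
    ← Complex.ofReal_sin, Complex.re_ofReal_mul, Complex.im_ofReal_mul, abs_mul, abs_of_nonneg hr,
    mul_left_comm]
  refine mul_le_mul_of_nonneg_left ?_ hr
  rw [div_mul_eq_mul_div, le_div_iff₀ hs, ← abs_of_pos hs, ← abs_mul, abs_le]
  simp only [Complex.mul_re, Complex.mul_im, Complex.add_re, Complex.add_im, Complex.ofReal_re,
    Complex.ofReal_im, Complex.I_re, Complex.I_im]
  constructor <;> nlinarith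

end FracDiff

end

/-! ### Toeplitz forms as integrals of the symbol. -/

noncomputable section

namespace FracDiff

open MeasureTheory

theorem norm_wCoeff_mul_circlePt_pow (α ψ : ℝ) (k : ℕ) :
    ‖((wCoeff α k : ℝ) : ℂ) * circlePt ψ ^ k‖ = |wCoeff α k| := by
  rw [norm_mul, norm_pow, norm_circlePt, one_pow, mul_one, Complex.norm_real, Real.norm_eq_abs]

theorem continuous_symbol {α : ℝ} (h1 : 1 < α) (h2 : α < 2) : Continuous (symbol α) := by
  unfold symbol
  refine ((continuous_circlePt.inv₀ circlePt_ne_zero).mul ?_).neg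
  refine continuous_tsum (fun k => continuous_const.mul (continuous_circlePt.pow k))
    (summable_abs_wCoeff h1 h2) fun k ψ => (norm_wCoeff_mul_circlePt_pow α ψ k).le

theorem hasSum_symbol_mul_zpow {α : ℝ} (h1 : 1 < α) (h2 : α < 2) (ψ : ℝ) (m : ℤ) :
    HasSum (fun k : ℕ => -((wCoeff α k : ℝ) : ℂ) * circlePt ψ ^ ((k : ℤ) - 1 + m))
      (symbol α ψ * circlePt ψ ^ m) := by
  have hs : Summable fun k : ℕ => ((wCoeff α k : ℝ) : ℂ) * circlePt ψ ^ k :=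
    Summable.of_norm_bounded (summable_abs_wCoeff h1 h2)
      fun k => (norm_wCoeff_mul_circlePt_pow α ψ k).le
  convert! (hs.hasSum.mul_left (-((circlePt ψ)⁻¹ * circlePt ψ ^ m))) using 1
  · funext k
    rw [zpow_add₀ (circlePt_ne_zero ψ), zpow_sub_one₀ (circlePt_ne_zero ψ), zpow_natCast]
    ring
  · rw [symbol]
    ring

theorem hasSum_integral_symbol {α : ℝ} (h1 : 1 < α) (h2 : α < 2) (m : ℤ) :
    HasSum (fun k : ℕ => -((wCoeff α k : ℝ) : ℂ) * if (k : ℤ) - 1 + m = 0 then (Real.pi : ℂ) else 0)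
      (∫ ψ in (0 : ℝ)..Real.pi, symbol α ψ * circlePt ψ ^ m) := by
  have hc : ∀ k : ℤ, Continuous fun ψ => circlePt ψ ^ k :=
    fun k => continuous_circlePt.zpow₀ k fun ψ => Or.inl (circlePt_ne_zero ψ)
  have := intervalIntegral.hasSum_integral_of_dominated_convergence (μ := volume)
    (a := 0) (b := Real.pi)
    (F := fun (k : ℕ) ψ => -((wCoeff α k : ℝ) : ℂ) * circlePt ψ ^ ((k : ℤ) - 1 + m))
    (f := fun ψ => symbol α ψ * circlePt ψ ^ m) (fun k _ => |wCoeff α k|)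
    (fun k => (continuous_const.mul (hc _)).aestronglyMeasurable)
    (fun k => by
      filter_upwards with ψ _
      rw [norm_mul, norm_zpow, norm_circlePt, one_zpow, mul_one, norm_neg, Complex.norm_real,
        Real.norm_eq_abs])
    (by filter_upwards with ψ _ using summable_abs_wCoeff h1 h2)
    intervalIntegrable_const
    (by filter_upwards with ψ _ using hasSum_symbol_mul_zpow h1 h2 ψ m)
  simpa only [intervalIntegral.integral_const_mul, integral_circlePt_zpow] using this

/-- Orthogonality of the powers of z leaves only k = p - q + 1, which is an index of the series
exactly when q ≤ p + 1. -/
theorem integral_symbol_eq_grunwaldMatrix {α : ℝ} (h1 : 1 < α) (h2 : α < 2) {m : ℕ}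
    (p q : Fin m) :
    ∫ ψ in (0 : ℝ)..Real.pi, symbol α ψ * circlePt ψ ^ ((q : ℤ) - (p : ℤ)) =
      Real.pi * ((grunwaldMatrix α m p q : ℝ) : ℂ) := by
  refine (hasSum_integral_symbol h1 h2 _).unique ?_
  rw [grunwaldMatrix, Matrix.of_apply]
  split_ifs with h
  · have := hasSum_single (f := fun k : ℕ => -((wCoeff α k : ℝ) : ℂ) *
      if (k : ℤ) - 1 + ((q : ℤ) - (p : ℤ)) = 0 then (Real.pi : ℂ) else 0) ((p : ℕ) + 1 - (q : ℕ))
      fun k hk => by rw [if_neg (by omega), mul_zero]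
    convert! this using 1
    rw [if_pos (by omega)]
    push_cast
    ring
  · convert! hasSum_zero using 1
    · funext k
      rw [if_neg (by omega), mul_zero]
    · simp

/-- The sesquilinear form `x* A x` of a real matrix on complex vectors. -/
def quadForm {ι : Type*} [Fintype ι] (A : Matrix ι ι ℝ) (x : ι → ℂ) : ℂ :=
  ∑ p, ∑ q, star (x p) * ((A p q : ℝ) : ℂ) * x q

/-- Since the entries are Fourier coefficients, the symbol is integrated against |∑ x_q z^q|² ≥ 0.
Any convex cone containing the symbol's values thus contains the form's values, whatever the matrix
size. -/
theorem pi_mul_quadForm_grunwaldMatrix {α : ℝ} (h1 : 1 < α) (h2 : α < 2) {m : ℕ}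
    (x : Fin m → ℂ) :
    Real.pi * quadForm (grunwaldMatrix α m) x =
      ∫ ψ in (0 : ℝ)..Real.pi,
        symbol α ψ * ((Complex.normSq (∑ q, x q * circlePt ψ ^ (q : ℕ)) : ℝ) : ℂ) := by
  have hc : ∀ k : ℤ, Continuous fun ψ => symbol α ψ * circlePt ψ ^ k := fun k =>
    (continuous_symbol h1 h2).mul
      (continuous_circlePt.zpow₀ k fun ψ => Or.inl (circlePt_ne_zero ψ))
  have hpt : ∀ ψ, symbol α ψ * ((Complex.normSq (∑ q, x q * circlePt ψ ^ (q : ℕ)) : ℝ) : ℂ) =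
      ∑ p, ∑ q, star (x p) * x q * (symbol α ψ * circlePt ψ ^ ((q : ℤ) - (p : ℤ))) := by
    intro ψ
    rw [Complex.normSq_eq_conj_mul_self, map_sum, Finset.sum_mul_sum,
      Finset.mul_sum]
    refine Finset.sum_congr rfl fun p _ => ?_
    rw [Finset.mul_sum]
    refine Finset.sum_congr rfl fun q _ => ?_
    rw [zpow_sub₀ (circlePt_ne_zero ψ), zpow_natCast, zpow_natCast, map_mul, map_pow,
      starRingEnd_apply (circlePt ψ), star_circlePt, starRingEnd_apply, inv_pow]
    ring
  simp_rw [hpt]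
  rw [intervalIntegral.integral_finsetSum, quadForm, Finset.mul_sum]
  · refine Finset.sum_congr rfl fun p _ => ?_
    rw [intervalIntegral.integral_finsetSum, Finset.mul_sum]
    · refine Finset.sum_congr rfl fun q _ => ?_
      rw [intervalIntegral.integral_const_mul, integral_symbol_eq_grunwaldMatrix h1 h2]
      ring
    · exact fun q _ => (continuous_const.mul (hc _)).intervalIntegrable _ _
  · exact fun p _ => (continuous_finsetSum _ fun q _ =>
      continuous_const.mul (hc _)).intervalIntegrable _ _

theorem abs_im_quadForm_grunwaldMatrix_le {α : ℝ} (h1 : 1 < α) (h2 : α < 2) {m : ℕ}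
    (x : Fin m → ℂ) :
    |(quadForm (grunwaldMatrix α m) x).im| ≤
      |Real.tan (α / 2 * Real.pi)| * (quadForm (grunwaldMatrix α m) x).re := by
  have hp := Real.pi_pos
  set P : ℝ → ℝ := fun ψ => Complex.normSq (∑ q, x q * circlePt ψ ^ (q : ℕ)) with hP
  have hPc : Continuous P := Complex.continuous_normSq.comp (continuous_finsetSum _ fun q _ =>
    continuous_const.mul (continuous_circlePt.pow _))
  have hfc := continuous_symbol h1 h2
  have hint : IntervalIntegrable (fun ψ => symbol α ψ * ((P ψ : ℝ) : ℂ)) volume 0 Real.pi :=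
    (hfc.mul (Complex.continuous_ofReal.comp hPc)).intervalIntegrable _ _
  have hQ := pi_mul_quadForm_grunwaldMatrix h1 h2 x
  have hre : Real.pi * (quadForm (grunwaldMatrix α m) x).re =
      ∫ ψ in (0 : ℝ)..Real.pi, (symbol α ψ).re * P ψ := by
    have := Complex.reCLM.intervalIntegral_comp_comm hint
    simp only [Complex.reCLM_apply, Complex.re_mul_ofReal] at this
    rw [this, ← hQ, Complex.re_ofReal_mul]
  have him : Real.pi * (quadForm (grunwaldMatrix α m) x).im =
      ∫ ψ in (0 : ℝ)..Real.pi, (symbol α ψ).im * P ψ := by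
    have := Complex.imCLM.intervalIntegral_comp_comm hint
    simp only [Complex.imCLM_apply, Complex.im_mul_ofReal] at this
    rw [this, ← hQ, Complex.im_ofReal_mul]
  have hrec : Continuous fun ψ => (symbol α ψ).re * P ψ := (Complex.continuous_re.comp hfc).mul hPc
  have himc : Continuous fun ψ => (symbol α ψ).im * P ψ := (Complex.continuous_im.comp hfc).mul hPc
  rw [← mul_le_mul_iff_right₀ hp, mul_left_comm, hre, ← intervalIntegral.integral_const_mul,
    ← abs_of_pos hp, ← abs_mul, abs_of_pos hp, him]
  refine (intervalIntegral.abs_integral_le_integral_abs hp.le).trans ?_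
  -- The open interval suffices; the endpoints, where z = 1, are not covered by the closed form.
  refine intervalIntegral.integral_mono_on_of_le_Ioo hp.le (himc.abs.intervalIntegrable _ _)
    ((continuous_const.mul hrec).intervalIntegrable _ _) fun ψ hψ => ?_
  rw [abs_mul, abs_of_nonneg (Complex.normSq_nonneg _ : 0 ≤ P ψ), ← mul_assoc]
  exact mul_le_mul_of_nonneg_right (abs_im_symbol_le h1 h2 hψ) (Complex.normSq_nonneg _)

end FracDiff

end

/-! ### Quadratic forms and Kronecker products. -/

noncomputable section

namespace FracDiff

section QuadForm

variable {ι : Type*} [Fintype ι]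

theorem quadForm_eq_dotProduct (A : Matrix ι ι ℝ) (x : ι → ℂ) :
    quadForm A x = dotProduct (star x) ((A.map (fun r : ℝ => (r : ℂ))).mulVec x) := by
  simp only [quadForm, dotProduct, Matrix.mulVec, Finset.mul_sum, Pi.star_apply,
    Matrix.map_apply, mul_assoc]

theorem quadForm_add (A B : Matrix ι ι ℝ) (x : ι → ℂ) :
    quadForm (A + B) x = quadForm A x + quadForm B x := by
  simp only [quadForm, ← Finset.sum_add_distrib, Matrix.add_apply]
  push_cast
  simp only [mul_add, add_mul]

theorem quadForm_smul (c : ℝ) (A : Matrix ι ι ℝ) (x : ι → ℂ) :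
    quadForm (c • A) x = c * quadForm A x := by
  simp only [quadForm, Finset.mul_sum, Matrix.smul_apply, smul_eq_mul]
  push_cast
  refine Finset.sum_congr rfl fun p _ => Finset.sum_congr rfl fun q _ => by ring

theorem quadForm_zero (x : ι → ℂ) : quadForm (0 : Matrix ι ι ℝ) x = 0 := by
  simp [quadForm]

theorem quadForm_sum {κ : Type*} (s : Finset κ) (A : κ → Matrix ι ι ℝ) (x : ι → ℂ) :
    quadForm (∑ i ∈ s, A i) x = ∑ i ∈ s, quadForm (A i) x := by
  classical
  induction s using Finset.induction_on with
  | empty => simp [quadForm_zero]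
  | insert i s hi ih => rw [Finset.sum_insert hi, Finset.sum_insert hi, quadForm_add, ih]

theorem quadForm_one [DecidableEq ι] (x : ι → ℂ) :
    quadForm (1 : Matrix ι ι ℝ) x = ((∑ p, Complex.normSq (x p) : ℝ) : ℂ) := by
  rw [quadForm, Complex.ofReal_sum]
  refine Finset.sum_congr rfl fun p _ => ?_
  rw [Finset.sum_eq_single p, Matrix.one_apply_eq, Complex.normSq_eq_conj_mul_self]
  · simp
  · intro q _ hq
    rw [Matrix.one_apply_ne hq.symm]
    simp
  · simp

theorem quadForm_transpose (A : Matrix ι ι ℝ) (x : ι → ℂ) :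
    quadForm A.transpose x = star (quadForm A x) := by
  simp only [quadForm, star_sum]
  rw [Finset.sum_comm]
  refine Finset.sum_congr rfl fun p _ => Finset.sum_congr rfl fun q _ => ?_
  simp [Matrix.transpose_apply]
  ring

end QuadForm

theorem kronAt_insertNth {d : ℕ} {n : Fin (d + 1) → ℕ} (i : Fin (d + 1))
    (B : Matrix (Fin (n i)) (Fin (n i)) ℝ) (r s : Fin (n i))
    (y z : (j : Fin d) → Fin (n (i.succAbove j))) :
    kronAt i B (i.insertNth r y : MultiIndex n) (i.insertNth s z : MultiIndex n) =
      if y = z then B r s else 0 := by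
  rw [kronAt, kron, Matrix.of_apply, Fin.prod_univ_succAbove _ i]
  simp only [Function.update_self, Fin.insertNth_apply_same, Fin.insertNth_apply_succAbove,
    ne_eq, Fin.succAbove_ne, not_false_eq_true, Function.update_of_ne, Matrix.one_apply]
  split_ifs with h
  · simp [h]
  · obtain ⟨j, hj⟩ := Function.ne_iff.1 h
    rw [Finset.prod_eq_zero (Finset.mem_univ j) (if_neg hj), mul_zero]

/-- The identity factors couple only entries lying on the same line in direction i, so the form
splits into one-dimensional forms, one per line. -/
theorem quadForm_kronAt {d : ℕ} {n : Fin (d + 1) → ℕ} (i : Fin (d + 1))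
    (B : Matrix (Fin (n i)) (Fin (n i)) ℝ) (x : MultiIndex n → ℂ) :
    quadForm (kronAt i B) x = ∑ y : (j : Fin d) → Fin (n (i.succAbove j)),
      quadForm B fun r => x (i.insertNth r y : MultiIndex n) := by
  have happ : ∀ (r : Fin (n i)) (z : (j : Fin d) → Fin (n (i.succAbove j))),
      Fin.insertNthEquiv (fun j => Fin (n j)) i (r, z) = (i.insertNth r z : MultiIndex n) :=
    fun _ _ => rfl
  simp only [quadForm]
  rw [← (Fin.insertNthEquiv (fun j => Fin (n j)) i).sum_comp, Fintype.sum_prod_type_right]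
  refine Finset.sum_congr rfl fun y _ => Finset.sum_congr rfl fun r _ => ?_
  rw [← (Fin.insertNthEquiv (fun j => Fin (n j)) i).sum_comp, Fintype.sum_prod_type]
  refine Finset.sum_congr rfl fun s _ => ?_
  simp only [happ, kronAt_insertNth]
  rw [Finset.sum_eq_single y]
  · simp
  · intro z _ hz
    simp [hz.symm]
  · simp

theorem abs_im_quadForm_kronAt_le {d : ℕ} {n : Fin d → ℕ} (i : Fin d)
    (B : Matrix (Fin (n i)) (Fin (n i)) ℝ) {t : ℝ}
    (hB : ∀ x, |(quadForm B x).im| ≤ t * (quadForm B x).re) (x : MultiIndex n → ℂ) :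
    |(quadForm (kronAt i B) x).im| ≤ t * (quadForm (kronAt i B) x).re := by
  cases d with
  | zero => exact i.elim0
  | succ d =>
    rw [quadForm_kronAt, Complex.im_sum, Complex.re_sum, Finset.mul_sum]
    exact (Finset.abs_sum_le_sum_abs _ _).trans (Finset.sum_le_sum fun y _ => hB _)

theorem quadForm_schemeMatrix {d : ℕ} (α dPlus dMinus a b : Fin d → ℝ) (τ : ℝ) (n : Fin d → ℕ)
    (x : MultiIndex n → ℂ) :
    quadForm (schemeMatrix α dPlus dMinus a b τ n) x =
      ((1 / τ : ℝ) : ℂ) * ((∑ p, Complex.normSq (x p) : ℝ) : ℂ) +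
      ∑ i, (((dPlus i / (2 * stepSize (a i) (b i) (n i) ^ α i) : ℝ) : ℂ) *
          quadForm (kronAt i (grunwaldMatrix (α i) (n i))) x +
        ((dMinus i / (2 * stepSize (a i) (b i) (n i) ^ α i) : ℝ) : ℂ) *
          star (quadForm (kronAt i (grunwaldMatrix (α i) (n i))) x)) := by
  simp only [schemeMatrix, quadForm_add, quadForm_sum, quadForm_smul, quadForm_one,
    quadForm_transpose]

/-! ### Sector and flip symmetry of the scheme matrix. -/

section Scheme

variable {d : ℕ} {α dPlus dMinus a b : Fin d → ℝ} {τ : ℝ} {n : Fin d → ℕ}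

theorem stepSize_pos {a b : ℝ} (hab : a < b) (m : ℕ) : 0 < stepSize a b m :=
  div_pos (sub_pos.2 hab) (by positivity)

theorem tan_pos_of_order {α : ℝ} (h1 : 1 < α) (h2 : α < 2) :
    0 < |Real.tan (α / 2 * Real.pi)| := by
  have hp := Real.pi_pos
  rw [abs_tan_eq h1 h2]
  exact div_pos (Real.cos_pos_of_mem_Ioo ⟨by nlinarith, by nlinarith⟩)
    (Real.sin_pos_of_pos_of_lt_pi (by nlinarith) (by nlinarith))

/-- The sector bound already contains this: 0 ≤ |Im| ≤ t Re with t > 0. -/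
theorem re_quadForm_kronAt_nonneg (hα : ∀ i, 1 < α i ∧ α i < 2) (i : Fin d)
    (x : MultiIndex n → ℂ) :
    0 ≤ (quadForm (kronAt i (grunwaldMatrix (α i) (n i))) x).re := by
  have h := abs_im_quadForm_kronAt_le i _
    (abs_im_quadForm_grunwaldMatrix_le (m := n i) (hα i).1 (hα i).2) x
  exact nonneg_of_mul_nonneg_right ((abs_nonneg _).trans h)
    (tan_pos_of_order (hα i).1 (hα i).2)

theorem re_quadForm_schemeMatrix_pos (hα : ∀ i, 1 < α i ∧ α i < 2)
    (hp : ∀ i, 0 ≤ dPlus i) (hm : ∀ i, 0 ≤ dMinus i) (hab : ∀ i, a i < b i) (hτ : 0 < τ)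
    {x : MultiIndex n → ℂ} (hx : x ≠ 0) :
    0 < (quadForm (schemeMatrix α dPlus dMinus a b τ n) x).re := by
  rw [quadForm_schemeMatrix, Complex.add_re, ← Complex.ofReal_mul, Complex.ofReal_re,
    Complex.re_sum]
  refine add_pos_of_pos_of_nonneg (mul_pos (one_div_pos.2 hτ) ?_)
    (Finset.sum_nonneg fun i _ => ?_)
  · obtain ⟨p, hp⟩ := Function.ne_iff.1 hx
    exact Finset.sum_pos' (fun _ _ => Complex.normSq_nonneg _)
      ⟨p, Finset.mem_univ _, Complex.normSq_pos.2 hp⟩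
  · have hh : 0 ≤ 2 * stepSize (a i) (b i) (n i) ^ α i :=
      mul_nonneg zero_le_two (Real.rpow_nonneg (stepSize_pos (hab i) _).le _)
    have hq := re_quadForm_kronAt_nonneg hα i x
    rw [Complex.add_re, Complex.re_ofReal_mul, Complex.re_ofReal_mul, Complex.star_def,
      Complex.conj_re]
    exact add_nonneg (mul_nonneg (div_nonneg (hp i) hh) hq) (mul_nonneg (div_nonneg (hm i) hh) hq)

theorem skewBound_nonneg [NeZero d] (hp : ∀ i, 0 ≤ dPlus i) (hm : ∀ i, 0 ≤ dMinus i) :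
    0 ≤ skewBound α dPlus dMinus :=
  (mul_nonneg (div_nonneg (abs_nonneg _) (add_nonneg (hp 0) (hm 0))) (abs_nonneg _)).trans
    (Finset.le_sup' (fun i : Fin d => |dPlus i - dMinus i| / (dPlus i + dMinus i) *
      |Real.tan (α i / 2 * Real.pi)|) (Finset.mem_univ 0))

/-- Transposition conjugates the form, so direction i has imaginary part scaled by d₊ - d₋ and real
part by d₊ + d₋. The step size is a common positive factor, and νI only adds to the real part. -/
theorem abs_im_quadForm_schemeMatrix_le [NeZero d] (hα : ∀ i, 1 < α i ∧ α i < 2)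
    (hp : ∀ i, 0 ≤ dPlus i) (hm : ∀ i, 0 ≤ dMinus i) (hab : ∀ i, a i < b i) (hτ : 0 < τ)
    (x : MultiIndex n → ℂ) :
    |(quadForm (schemeMatrix α dPlus dMinus a b τ n) x).im| ≤
      skewBound α dPlus dMinus * (quadForm (schemeMatrix α dPlus dMinus a b τ n) x).re := by
  rw [quadForm_schemeMatrix, Complex.add_re, Complex.add_im, ← Complex.ofReal_mul,
    Complex.ofReal_re, Complex.ofReal_im, zero_add, Complex.re_sum, Complex.im_sum, mul_add,
    Finset.mul_sum (Finset.univ : Finset (Fin d))]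
  refine (Finset.abs_sum_le_sum_abs _ _).trans
    ((Finset.sum_le_sum fun i _ => ?_).trans (le_add_of_nonneg_left ?_))
  · have hh : 0 < 2 * stepSize (a i) (b i) (n i) ^ α i :=
      mul_pos two_pos (Real.rpow_pos_of_pos (stepSize_pos (hab i) _) _)
    have hq := re_quadForm_kronAt_nonneg (n := n) hα i x
    have hi := abs_im_quadForm_kronAt_le i _
      (abs_im_quadForm_grunwaldMatrix_le (m := n i) (hα i).1 (hα i).2) x
    have hle := Finset.le_sup' (fun i : Fin d => |dPlus i - dMinus i| / (dPlus i + dMinus i) *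
      |Real.tan (α i / 2 * Real.pi)|) (Finset.mem_univ i)
    rw [← skewBound] at hle
    rw [Complex.add_re, Complex.re_ofReal_mul, Complex.re_ofReal_mul, Complex.add_im,
      Complex.im_ofReal_mul, Complex.im_ofReal_mul, Complex.star_def, Complex.conj_re,
      Complex.conj_im]
    generalize quadForm (kronAt i (grunwaldMatrix (α i) (n i))) x = Q at *
    generalize 2 * stepSize (a i) (b i) (n i) ^ α i = h at *
    have e1 : dPlus i / h * Q.im + dMinus i / h * -Q.im = (dPlus i - dMinus i) * Q.im / h := by
      ring
    have e2 : skewBound α dPlus dMinus * (dPlus i / h * Q.re + dMinus i / h * Q.re) =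
        skewBound α dPlus dMinus * (dPlus i + dMinus i) * Q.re / h := by ring
    rw [e1, e2, abs_div, abs_of_pos hh, abs_mul]
    refine div_le_div_of_nonneg_right ?_ hh.le
    refine (mul_le_mul_of_nonneg_left hi (abs_nonneg _)).trans ?_
    rw [← mul_assoc]
    refine mul_le_mul_of_nonneg_right ?_ hq
    -- If d₊ = d₋ = 0, both sides vanish; otherwise the i-th term of the maximum applies after
    -- clearing the denominator.
    rcases (add_nonneg (hp i) (hm i)).eq_or_lt with h0 | h0
    · have h3 : dPlus i = 0 := by linarith [hp i, hm i]
      have h4 : dMinus i = 0 := by linarith [hp i, hm i]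
      simp [h3, h4]
    · rwa [div_mul_eq_mul_div, div_le_iff₀ h0] at hle
  · exact mul_nonneg (skewBound_nonneg hp hm) (mul_nonneg (one_div_pos.2 hτ).le
      (Finset.sum_nonneg fun _ _ => Complex.normSq_nonneg _))

/-- Toeplitz entries depend only on p - q, and reversing both indices negates this difference. -/
theorem grunwaldMatrix_rev (α : ℝ) {m : ℕ} (p q : Fin m) :
    grunwaldMatrix α m p.rev q.rev = grunwaldMatrix α m q p := by
  simp only [grunwaldMatrix, Matrix.of_apply, Fin.val_rev]
  have hp := p.isLt
  have hq := q.isLt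
  split_ifs with h1 h2 h2
  · congr 2
    omega
  · omega
  · omega
  · rfl

theorem multiFlip_apply (p q : MultiIndex n) :
    multiFlip n p q = if q = fun i => (p i).rev then 1 else 0 := by
  simp only [multiFlip, kron, flipMatrix, Matrix.of_apply]
  split_ifs with h
  · refine Finset.prod_eq_one fun i _ => if_pos ?_
    have := (p i).isLt
    rw [h, Fin.val_rev]
    omega
  · obtain ⟨i, hi⟩ := Function.ne_iff.1 h
    refine Finset.prod_eq_zero (Finset.mem_univ i) (if_neg fun h2 => hi ?_)
    rw [Fin.ext_iff, Fin.val_rev]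
    omega

theorem multiFlip_mul_apply (A : Matrix (MultiIndex n) (MultiIndex n) ℝ) (p q : MultiIndex n) :
    (multiFlip n * A) p q = A (fun i => (p i).rev) q := by
  simp [Matrix.mul_apply, multiFlip_apply]

theorem mul_multiFlip_apply (A : Matrix (MultiIndex n) (MultiIndex n) ℝ) (p q : MultiIndex n) :
    (A * multiFlip n) p q = A p fun i => (q i).rev := by
  rw [Matrix.mul_apply, Finset.sum_eq_single fun i => (q i).rev]
  · simp [multiFlip_apply]
  · intro r _ hr
    rw [multiFlip_apply, if_neg, mul_zero]
    rintro rfl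
    simp at hr
  · simp

theorem multiFlip_mul_self : multiFlip n * multiFlip n = 1 := by
  ext p q
  rw [multiFlip_mul_apply, multiFlip_apply, Matrix.one_apply]
  simp [eq_comm]

theorem kronAt_rev (i : Fin d) (B : Matrix (Fin (n i)) (Fin (n i)) ℝ)
    (hB : ∀ p q, B (Fin.rev p) (Fin.rev q) = B q p) (p q : MultiIndex n) :
    kronAt i B (fun j => (p j).rev) (fun j => (q j).rev) = kronAt i B q p := by
  simp only [kronAt, kron, Matrix.of_apply]
  refine Finset.prod_congr rfl fun j _ => ?_
  rcases eq_or_ne j i with rfl | hj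
  · simp [hB]
  · simp [hj, Matrix.one_apply, eq_comm]

theorem multiFlip_mul_schemeMatrix_mul_multiFlip :
    multiFlip n * schemeMatrix α dPlus dMinus a b τ n * multiFlip n =
      (schemeMatrix α dPlus dMinus a b τ n).transpose := by
  ext p q
  have hone : (1 : Matrix (MultiIndex n) (MultiIndex n) ℝ)
      (fun i => (p i).rev) (fun i => (q i).rev) = (1 : Matrix (MultiIndex n) (MultiIndex n) ℝ) q p := by
    simp [Matrix.one_apply, funext_iff, eq_comm]
  rw [mul_multiFlip_apply, multiFlip_mul_apply, Matrix.transpose_apply]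
  simp only [schemeMatrix, Matrix.add_apply, Matrix.sum_apply, Matrix.smul_apply,
    Matrix.transpose_apply, kronAt_rev _ _ (grunwaldMatrix_rev _), hone]

end Scheme

end FracDiff

end

/-! ### From the sector to the eigenvalues. -/

noncomputable section

namespace FracDiff

section LinearAlgebra

variable {ι : Type*} [Fintype ι] [DecidableEq ι]

/-- The square of an eigenvalue of `H⁻¹ Y A` is `1 + s²`, where `i s` is an eigenvalue of
`H⁻¹ (A - H)`. -/
theorem exists_sq_eq_one_add_sq {A Y G H : Matrix ι ι ℂ} {t : ℝ} (hY : Y * Y = 1)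
    (hYA : Y * A * Y = A.conjTranspose) (hH : (2 : ℂ) • H = A + A.conjTranspose) (hG : H * G = 1)
    (hpos : ∀ x : ι → ℂ, x ≠ 0 → 0 < (dotProduct (star x) (A.mulVec x)).re)
    (hsec : ∀ x : ι → ℂ, |(dotProduct (star x) (A.mulVec x)).im| ≤
      t * (dotProduct (star x) (A.mulVec x)).re)
    {v : ι → ℂ} (hv : v ≠ 0) {l : ℂ} (hl : (G * (Y * A)).mulVec v = l • v) :
    ∃ s : ℝ, |s| ≤ t ∧ l ^ 2 = ((1 + s ^ 2 : ℝ) : ℂ) := by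
  have hGH : G * H = 1 := mul_eq_one_comm.1 hG
  have hYA' : Y * A.conjTranspose * Y = A := by
    rw [← hYA, show Y * (Y * A * Y) * Y = (Y * Y) * A * (Y * Y) by noncomm_ring, hY, one_mul,
      mul_one]
  have hYH : Y * H * Y = H := by
    have h2 : (2 : ℂ) • (Y * H * Y) = (2 : ℂ) • H := by
      rw [← Matrix.smul_mul, ← Matrix.mul_smul, hH, mul_add, add_mul, hYA, hYA', add_comm]
    exact smul_right_injective _ (two_ne_zero (α := ℂ)) h2
  have hGY : G * Y = Y * G := by
    calc G * Y = G * Y * (H * G) := by rw [hG, mul_one]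
      _ = G * (Y * H * Y) * (Y * G) := by
        rw [show G * (Y * H * Y) * (Y * G) = G * Y * H * (Y * Y) * G by noncomm_ring, hY]
        noncomm_ring
      _ = Y * G := by rw [hYH, hGH, one_mul]
  set K := G * A - 1 with hK
  have hGA : G * A.conjTranspose = 1 - K := by
    have : A.conjTranspose = (2 : ℂ) • H - A := by rw [hH, add_sub_cancel_left]
    rw [this, mul_sub, Matrix.mul_smul, hGH, hK, two_smul]
    abel
  have hsq : (G * (Y * A)) * (G * (Y * A)) = 1 - K * K := by
    calc (G * (Y * A)) * (G * (Y * A)) = G * Y * A * (G * Y) * A := by noncomm_ring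
      -- The net effect of the rewrites is to turn only the second G * Y into Y * G.
      _ = G * (Y * A * Y) * (G * A) := by rw [hGY, ← hGY]; nth_rewrite 2 [hGY]; noncomm_ring
      _ = (1 - K) * (1 + K) := by rw [hYA, hGA, hK]; noncomm_ring
      _ = 1 - K * K := by noncomm_ring
  obtain ⟨κ, hκ⟩ := IsAlgClosed.exists_eq_mul_self (1 - l ^ 2)
  have hKv : (K * K).mulVec v = (κ * κ) • v := by
    have h1 : ((G * (Y * A)) * (G * (Y * A))).mulVec v = (l * l) • v := by
      rw [← Matrix.mulVec_mulVec, hl, Matrix.mulVec_smul, hl, smul_smul]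
    rw [hsq, Matrix.sub_mulVec, Matrix.one_mulVec, sub_eq_iff_eq_add] at h1
    rw [← hκ, sub_smul, one_smul, pow_two, eq_sub_iff_add_eq, add_comm]
    exact h1.symm
  -- As (K + κ)(K - κ)v = 0, either v is an eigenvector for κ or (K - κ)v is one for -κ. No
  -- diagonalisation of K is needed.
  obtain ⟨k, u, hk, hu, hKu⟩ : ∃ (k : ℂ) (u : ι → ℂ), k * k = κ * κ ∧ u ≠ 0 ∧
      K.mulVec u = k • u := by
    by_cases h : K.mulVec v = κ • v
    · exact ⟨κ, v, rfl, hv, h⟩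
    · refine ⟨-κ, K.mulVec v - κ • v, by ring, sub_ne_zero.2 h, ?_⟩
      rw [Matrix.mulVec_sub, Matrix.mulVec_smul, Matrix.mulVec_mulVec, hKv, smul_sub, smul_smul]
      simp only [neg_smul, neg_mul]
      abel
  have hAu : A.mulVec u = (1 + k) • H.mulVec u := by
    have h1 : (G * A).mulVec u = (1 + k) • u := by
      rw [show G * A = 1 + K by rw [hK]; abel, Matrix.add_mulVec, Matrix.one_mulVec, hKu, add_smul,
        one_smul]
    rw [← Matrix.mulVec_smul, ← h1, Matrix.mulVec_mulVec, ← mul_assoc, hG, one_mul]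
  set Q := dotProduct (star u) (A.mulVec u) with hQ
  have hQH : dotProduct (star u) (H.mulVec u) = (Q.re : ℂ) := by
    have h1 : dotProduct (star u) (A.conjTranspose.mulVec u) = star Q := by
      rw [hQ, Matrix.star_dotProduct, Matrix.star_mulVec,
        Matrix.conjTranspose_conjTranspose, ← Matrix.dotProduct_mulVec]
    have h2 : 2 * dotProduct (star u) (H.mulVec u) = Q + star Q := by
      rw [← h1, hQ, ← dotProduct_add, ← Matrix.add_mulVec, ← hH, Matrix.smul_mulVec,
        dotProduct_smul, smul_eq_mul]
    rw [Complex.star_def, Complex.add_conj] at h2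
    push_cast at h2
    exact mul_left_cancel₀ two_ne_zero h2
  have hre : 0 < Q.re := hpos u hu
  have hQk : Q = (1 + k) * (Q.re : ℂ) := by
    conv_lhs => rw [hQ, hAu, dotProduct_smul, hQH, smul_eq_mul]
  -- Comparing u*Au = Q with u*Hu = Re Q gives 1 + k = Q / Re Q, so k is purely imaginary.
  have hkim : k = ((Q.im / Q.re : ℝ) : ℂ) * Complex.I := by
    have hne : (Q.re : ℂ) ≠ 0 := by exact_mod_cast hre.ne'
    have h1 := Complex.re_add_im Q
    rw [Complex.ofReal_div, div_mul_eq_mul_div, eq_div_iff hne]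
    linear_combination -h1 - hQk
  refine ⟨Q.im / Q.re, ?_, ?_⟩
  · rw [abs_div, abs_of_pos hre, div_le_iff₀ hre]
    exact hsec u
  · have h1 : l ^ 2 = 1 - k * k := by rw [hk, ← hκ]; ring
    rw [h1, hkim]
    push_cast
    linear_combination (-((Q.im : ℂ) / Q.re) ^ 2) * Complex.I_sq

theorem exists_real_of_sq_eq {l : ℂ} {s t : ℝ} (ht : |s| ≤ t)
    (hl : l ^ 2 = ((1 + s ^ 2 : ℝ) : ℂ)) :
    ∃ x : ℝ, l = x ∧
      x ∈ Set.Icc (-Real.sqrt (1 + t ^ 2)) (-1) ∪ Set.Icc 1 (Real.sqrt (1 + t ^ 2)) := by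
  have h0 : 0 ≤ 1 + s ^ 2 := by positivity
  have hlow : 1 ≤ Real.sqrt (1 + s ^ 2) := Real.one_le_sqrt.2 (by nlinarith)
  have hup : Real.sqrt (1 + s ^ 2) ≤ Real.sqrt (1 + t ^ 2) := by
    refine Real.sqrt_le_sqrt (by linarith [sq_le_sq' (abs_le.1 ht).1 (abs_le.1 ht).2])
  have hsq : l ^ 2 = ((Real.sqrt (1 + s ^ 2) : ℝ) : ℂ) ^ 2 := by
    rw [hl, ← Complex.ofReal_pow, Real.sq_sqrt h0]
  rcases sq_eq_sq_iff_eq_or_eq_neg.1 hsq with h | h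
  · exact ⟨_, h, Or.inr ⟨hlow, hup⟩⟩
  · exact ⟨_, by rw [h, Complex.ofReal_neg], Or.inl ⟨neg_le_neg hup, neg_le_neg hlow⟩⟩

/-- For a null vector v of the symmetric part, Re(v*Av) = v*Hv = 0, contradicting positivity. -/
theorem isUnit_det_symPart {A : Matrix ι ι ℝ} (hpos : ∀ x, x ≠ 0 → 0 < (quadForm A x).re) :
    IsUnit (symPart A).det := by
  rw [isUnit_iff_ne_zero]
  intro h
  obtain ⟨v, hv, hv0⟩ := Matrix.exists_mulVec_eq_zero_iff.2 h
  set x : ι → ℂ := fun i => (v i : ℂ) with hx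
  have hx0 : x ≠ 0 := by
    obtain ⟨i, hi⟩ := Function.ne_iff.1 hv
    exact Function.ne_iff.2 ⟨i, by simpa [hx] using hi⟩
  have h1 : quadForm (symPart A) x = 0 := by
    have : ∀ p, ∑ q, symPart A p q * v q = 0 := fun p => congrFun hv0 p
    rw [quadForm]
    refine Finset.sum_eq_zero fun p _ => ?_
    simp_rw [mul_assoc]
    rw [← Finset.mul_sum]
    simp only [hx, ← Complex.ofReal_mul, ← Complex.ofReal_sum, this, Complex.ofReal_zero, mul_zero]
  rw [symPart, quadForm_smul, quadForm_add, quadForm_transpose] at h1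
  have h2 := congrArg Complex.re h1
  rw [Complex.re_ofReal_mul, Complex.add_re, Complex.star_def, Complex.conj_re,
    Complex.zero_re] at h2
  linarith [hpos x hx0]

theorem eigenvalue_mem_of_sector {A Y : Matrix ι ι ℝ} {t : ℝ} (hY : Y * Y = 1)
    (hYA : Y * A * Y = A.transpose) (hpos : ∀ x, x ≠ 0 → 0 < (quadForm A x).re)
    (hsec : ∀ x, |(quadForm A x).im| ≤ t * (quadForm A x).re) {l : ℂ}
    (hl : Module.End.HasEigenvalue
      (Matrix.toLin' (((symPart A)⁻¹ * (Y * A)).map (fun x : ℝ => (x : ℂ)))) l) :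
    ∃ x : ℝ, l = x ∧
      x ∈ Set.Icc (-Real.sqrt (1 + t ^ 2)) (-1) ∪ Set.Icc 1 (Real.sqrt (1 + t ^ 2)) := by
  obtain ⟨v, hv⟩ := hl.exists_hasEigenvector
  have hv0 := hv.2
  have hv1 := hv.apply_eq_smul
  rw [Matrix.toLin'_apply] at hv1
  set φ : Matrix ι ι ℝ →+* Matrix ι ι ℂ := Complex.ofRealHom.mapMatrix with hφ
  have hφe : ∀ M : Matrix ι ι ℝ, M.map (fun x : ℝ => (x : ℂ)) = φ M := fun _ => rfl
  have hφt : ∀ M : Matrix ι ι ℝ, φ M.transpose = (φ M).conjTranspose := by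
    intro M
    ext p q
    simp [hφ, Matrix.conjTranspose_apply]
  rw [hφe, map_mul, map_mul] at hv1
  simp only [quadForm_eq_dotProduct, hφe] at hpos hsec
  obtain ⟨s, hs, hls⟩ := exists_sq_eq_one_add_sq (A := φ A) (Y := φ Y) (G := φ (symPart A)⁻¹)
    (H := φ (symPart A)) (by rw [← map_mul, hY, map_one]) (by rw [← map_mul, ← map_mul, hYA, hφt])
    (by
      rw [← hφt, ← map_add, symPart]
      ext p q
      simp [hφ]
      ring)
    (by
      rw [← map_mul, Matrix.mul_nonsing_inv, map_one]
      refine isUnit_det_symPart fun x hx => ?_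
      rw [quadForm_eq_dotProduct, hφe]
      exact hpos x hx)
    hpos hsec hv0 hv1
  exact exists_real_of_sq_eq hs hls

end LinearAlgebra

end FracDiff

end

/-! ### The main theorem. -/

theorem mainTheorem7 (d : ℕ) [NeZero d] (α dPlus dMinus : Fin d → ℝ)
    (hα : ∀ i, 1 < α i ∧ α i < 2)
    (hdPlus : ∀ i, 0 ≤ dPlus i) (hdMinus : ∀ i, 0 ≤ dMinus i) :
    ∃ ε : ℝ, 0 ≤ ε ∧ ε ≤ FracDiff.skewBound α dPlus dMinus ∧
      (0 < FracDiff.skewBound α dPlus dMinus → ε < FracDiff.skewBound α dPlus dMinus) ∧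
      ∀ (a b : Fin d → ℝ), (∀ i, a i < b i) →
      ∀ (T : ℝ), 0 < T → ∀ (M : ℕ), 0 < M →
      ∀ (n : Fin d → ℕ), (∀ i, 0 < n i) →
        IsUnit (FracDiff.symPart
          (FracDiff.schemeMatrix α dPlus dMinus a b (T / (M : ℝ)) n)).det ∧
        ∀ μ : ℂ,
          Module.End.HasEigenvalue
            (Matrix.toLin'
              (((FracDiff.symPart (FracDiff.schemeMatrix α dPlus dMinus a b (T / (M : ℝ)) n))⁻¹ *
                (FracDiff.multiFlip n *
                  FracDiff.schemeMatrix α dPlus dMinus a b (T / (M : ℝ)) n)).map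
                (fun x : ℝ => (x : ℂ)))) μ →
          ∃ x : ℝ, μ = (x : ℂ) ∧
            x ∈ Set.Icc (-(1 + ε)) (-1) ∪ Set.Icc 1 (1 + ε) := by
  have hμ := FracDiff.skewBound_nonneg (α := α) hdPlus hdMinus
  set μ₀ := FracDiff.skewBound α dPlus dMinus with hμ₀
  have hlow : 1 ≤ Real.sqrt (1 + μ₀ ^ 2) := Real.one_le_sqrt.2 (by nlinarith)
  -- This ε makes 1 + ε the bound √(1 + μ²) on |l|. It is at most μ because 1 + μ² ≤ (1 + μ)²,
  -- strictly so when μ > 0.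
  refine ⟨Real.sqrt (1 + μ₀ ^ 2) - 1, by linarith, ?_, fun h => ?_, ?_⟩
  · rw [sub_le_iff_le_add]
    exact (Real.sqrt_le_left (by linarith)).2 (by nlinarith)
  · rw [sub_lt_iff_lt_add]
    exact (Real.sqrt_lt' (by linarith)).2 (by nlinarith)
  · intro a b hab T hT M hM n hn
    have hτ : 0 < T / (M : ℝ) := div_pos hT (by exact_mod_cast hM)
    have hpos := fun (x : FracDiff.MultiIndex n → ℂ) (hx : x ≠ 0) =>
      FracDiff.re_quadForm_schemeMatrix_pos hα hdPlus hdMinus hab hτ hx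
    refine ⟨FracDiff.isUnit_det_symPart hpos, fun μ hμe => ?_⟩
    rw [add_sub_cancel]
    exact FracDiff.eigenvalue_mem_of_sector FracDiff.multiFlip_mul_self
      FracDiff.multiFlip_mul_schemeMatrix_mul_multiFlip hpos
      (FracDiff.abs_im_quadForm_schemeMatrix_le hα hdPlus hdMinus hab hτ) hμe
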